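/- Fix a nonprincipal ultrafilter on $\mathbb N$ and denote ultrapowers with respect to it by ${}^{\ast}(\cdot)$. Let ${}^{\ast}\mathbb R_{\rm fin}$ be the ring of bounded elements of ${}^{\ast}\mathbb R$ and let ${}^{\star}\mathbb{PR}=({}^{\ast}\mathbb R_{>0}\cup\{0\})/({}^{\ast}\mathbb R_{\rm fin})^{\times}_{>0}$, ordered by representatives, with the induced product, with tropical sum $\mu+\nu:=\max(\mu,\nu)$ and with least element $-\infty$ the class of $0$. Write $\langle x\rangle$ for the class of $|x|$, put $\langle x\rangle^{r}:=\langle |x|^{r}\rangle$ for $r\in{}^{\ast}\mathbb R_{\rm fin}$ (this is well defined), and put ${}^{\star}\mathbb{PR}_{\varepsilon}:=\{\mu<1\}$, the classes of infinitesimals. For $f=a\prod_{i=1}^{m}(X-\alpha_i)$ and $g=b\prod_{j=1}^{n}(X-\beta_j)$ nonzero in $\mathbb Z[X]$ (roots in $\mathbb C$, with multiplicity) let $f\boxtimes g=a^{n}b^{m}\prod_{i,j}(X-\alpha_i\beta_j)\in\mathbb Z[X]$, and let $f\boxtimes g=0$ if $f=0$ or $g=0$. Extend $\boxtimes$ to ${}^{\ast}\tilde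 Z:={}^{\ast}(\mathbb Z[X])$ by ${}^{\ast}\{f_i\}\boxtimes{}^{\ast}\{g_i\}={}^{\ast}\{f_i\boxtimes g_i\}$; degree, height $\mathfrak h$ (maximal absolute value of a coefficient), Mahler measure $\mathfrak m$ and evaluation at a real number are extended to ${}^{\ast}\tilde Z$ in the same way. For $\theta\in\mathbb R$ and $d\in{}^{\ast}\mathbb N$, $d\ge 1$, possibly infinite, let ${}^{\ast}\tilde Z(\theta)_{d}$ be the set of $f\in{}^{\ast}\tilde Z$ with $\deg f\le d$ and $f(\theta)$ infinitesimal. For such $f$ put $$\mathfrak m_d(f)=\mathfrak m(f)^{1/d},\qquad \mu_d(f)=\langle \mathfrak h(f)^{-1/d}\rangle\ (=\langle\mathfrak m_d(f)^{-1}\rangle),\qquad \nu_d(f)=\langle |f(\theta)|^{1/d}\rangle,$$ where $\mu_d(0)$ is taken to be larger than every element of ${}^{\star}\mathbb{PR}$. For $e\in{}^{\ast}\mathbb N$, $e\geq 1$, let ${}^{\ast}\tilde Z^{\mu}(\theta)_d$ be the set of $f\in{}^{\ast}\tilde Z(\theta)_d$ with $\mu_d(f)>\mu$, and let ${}^{\ast}\tilde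 Z^{\mu}_{\nu^{e}}(\theta)_d$ be the set of those which satisfy in addition $\nu_d(f)^{1/e}\le\nu$. Theorem. Let $\theta,\eta\in\mathbb R$ and let $d,e\in{}^{\ast}\mathbb N$ with $d,e\ge1$. 1. For all $f\in{}^{\ast}\tilde Z(\theta)_{d}$ and $g\in{}^{\ast}\tilde Z(\eta)_{e}$, the decay of $f\boxtimes g$ at $\theta\eta$ satisfies, in ${}^{\star}\mathbb{PR}$, $$\nu_{de}(f\boxtimes g)\le\Big(\mathfrak m_d(f)^{1-1/e}\,\mathfrak m_e(g)\cdot\nu_d(f)^{1/e}\Big)+\Big(\mathfrak m_d(f)\,\mathfrak m_e(g)^{1-1/d}\cdot\nu_e(g)^{1/d}\Big).$$ 2. Consequently, for all $\mu,\nu\in{}^{\star}\mathbb{PR}_{\varepsilon}$, the resultant product defines a map $${}^{\ast}\tilde Z^{\mu}_{(\mu^{1-1/e}\cdot\nu)^{e}}(\theta)_{d}\times{}^{\ast}\tilde Z^{\nu}_{(\mu\cdot\nu^{1-1/d})^{d}}(\eta)_{e}\stackrel{\boxtimes}{\longrightarrow}{}^{\ast}\tilde Z^{\mu\cdot\nu}(\theta\eta)_{de}.$$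 This product is Cauchy bilinear: $(ff')\boxtimes g=(f\boxtimes g)(f'\boxtimes g)$ and $f\boxtimes(gg')=(f\boxtimes g)(f\boxtimes g')$ for all $f,f',g,g'\in{}^{\ast}\tilde Z$. It agrees with the product of numerator-denominator pairs on linear polynomials: $(aX-b)\boxtimes(a'X-b')=aa'X-bb'$ for $a,b,a',b'\in{}^{\ast}\mathbb Z$ with $a,a'\ne0$. -/

import Mathlib

open Polynomial

noncomputable section

namespace PolyApprox

/-! ### The resultant product of integral polynomials -/

/-- The complex polynomial `a ^ n * b ^ m * ∏ (X - αᵢ βⱼ)`, where `f = a ∏ (X - αᵢ)` has degree `m`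
and `g = b ∏ (X - βⱼ)` has degree `n`; the roots are counted with multiplicity. -/
def rootProduct (f g : ℤ[X]) : ℂ[X] :=
  C ((f.leadingCoeff : ℂ) ^ g.natDegree * (g.leadingCoeff : ℂ) ^ f.natDegree) *
    (((f.map (Int.castRingHom ℂ)).roots ×ˢ (g.map (Int.castRingHom ℂ)).roots).map
      fun p => X - C (p.1 * p.2)).prod

lemma scaleRoots_prod (s : Multiset ℂ) (b : ℂ) :
    (s.map fun a => X - C a).prod.scaleRoots b = (s.map fun a => X - C (a * b)).prod := by
  induction s using Multiset.induction with
  | empty => simp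
  | cons a s ih =>
    rw [Multiset.map_cons, Multiset.prod_cons, mul_scaleRoots_of_noZeroDivisors, ih,
      X_sub_C_scaleRoots, Multiset.map_cons, Multiset.prod_cons]

/-- The polynomial defined through the products of the roots has integral coefficients (it is, up
to sign, a resultant). -/
lemma exists_map_eq_rootProduct (f g : ℤ[X]) :
    ∃ h : ℤ[X], h.map (Int.castRingHom ℂ) = rootProduct f g := by
  have hinj : Function.Injective (Int.castRingHom ℂ) := RingHom.injective_int _
  set F := f.map (Int.castRingHom ℂ) with hF
  set G := g.map (Int.castRingHom ℂ) with hG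
  have hFd : F.natDegree = f.natDegree := natDegree_map_eq_of_injective hinj f
  have hGd : G.natDegree = g.natDegree := natDegree_map_eq_of_injective hinj g
  have hFl : F.leadingCoeff = (f.leadingCoeff : ℂ) := by
    rw [hF, leadingCoeff_map_of_injective hinj]; simp
  have hGl : G.leadingCoeff = (g.leadingCoeff : ℂ) := by
    rw [hG, leadingCoeff_map_of_injective hinj]; simp
  -- the polynomial `Yᵐ f(X / Y)` in the variable `Y`
  let S : ℤ[X][X] := ∑ i ∈ Finset.range (f.natDegree + 1),
    C (C (f.coeff i) * X ^ i) * X ^ (f.natDegree - i)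
  let φ : ℤ[X] →+* ℂ[X] := mapRingHom (Int.castRingHom ℂ)
  have hGC : (g.map C).map φ = G.map C := by
    rw [Polynomial.map_map, hG, Polynomial.map_map]
    congr 1
    ext
    simp
  have hCinj : Function.Injective (C : ℂ →+* ℂ[X]) := C_injective
  have hGCd : (G.map C).natDegree = g.natDegree := by
    rw [natDegree_map_eq_of_injective hCinj, hGd]
  have hGs : G.Splits := IsAlgClosed.splits G
  have hSd : (S.map φ).natDegree ≤ f.natDegree := by
    refine natDegree_map_le.trans ?_
    refine natDegree_sum_le_of_forall_le _ _ fun i _ => ?_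
    refine (natDegree_C_mul_X_pow_le _ _).trans (Nat.sub_le _ _)
  have heval : ∀ b : ℂ, (S.map φ).eval (C b) = F.scaleRoots b := by
    intro b
    ext k
    rw [coeff_scaleRoots, hFd, hF, coeff_map]
    simp only [S, φ, Polynomial.map_sum, eval_finsetSum, Polynomial.map_mul, map_C,
      Polynomial.map_pow, map_X, eval_mul, eval_C, eval_pow, eval_X, finsetSum_coeff,
      coe_mapRingHom]
    have : ∀ i, ((C ((Int.castRingHom ℂ) (f.coeff i)) * X ^ i * C b ^ (f.natDegree - i) : ℂ[X])).coeff k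
        = if k = i then (Int.castRingHom ℂ) (f.coeff i) * b ^ (f.natDegree - i) else 0 := by
      intro i
      rw [← C_pow, coeff_mul_C, coeff_C_mul_X_pow]
      split_ifs <;> simp
    simp only [this]
    rw [Finset.sum_ite_eq]
    split_ifs with h
    · rfl
    · rw [coeff_eq_zero_of_natDegree_lt]
      · simp
      · simpa [Nat.lt_succ_iff] using h
  refine ⟨resultant (g.map C) S g.natDegree f.natDegree, ?_⟩
  change φ _ = _
  rw [← resultant_map_map, hGC]
  have key := resultant_eq_prod_eval (G.map C) (S.map φ) f.natDegree hSd (hGs.map C)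
  rw [hGCd] at key
  rw [key, leadingCoeff_map_of_injective hCinj, hGl,
    ← roots_map_of_injective_of_card_eq_natDegree hCinj hGs.natDegree_eq_card_roots.symm,
    Multiset.map_map]
  have hfac : F = C F.leadingCoeff * (F.roots.map fun a => X - C a).prod :=
    (IsAlgClosed.splits F).eq_prod_roots
  have hsc : ∀ b : ℂ, F.scaleRoots b =
      C (f.leadingCoeff : ℂ) * (F.roots.map fun a => X - C (a * b)).prod := by
    intro b
    conv_lhs => rw [hfac]
    rw [mul_scaleRoots_of_noZeroDivisors, scaleRoots_C, scaleRoots_prod, hFl]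
  have hcomp : (fun b : ℂ => (S.map φ).eval (C b)) = fun b =>
      C (f.leadingCoeff : ℂ) * (F.roots.map fun a => X - C (a * b)).prod := by
    funext b; rw [heval, hsc]
  have hcard : Multiset.card G.roots = g.natDegree := by
    rw [← hGd]; exact hGs.natDegree_eq_card_roots.symm
  have hswap : ((F.roots ×ˢ G.roots).map fun p : ℂ × ℂ => (X - C (p.1 * p.2) : ℂ[X])).prod =
      (G.roots.map fun b => (F.roots.map fun a => (X - C (a * b) : ℂ[X])).prod).prod := by
    rw [Multiset.prod_map_product_eq_prod_prod, Multiset.prod_map_prod_map]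
  change C (g.leadingCoeff : ℂ) ^ f.natDegree *
    (G.roots.map (fun b : ℂ => (S.map φ).eval (C b))).prod = _
  rw [hcomp, Multiset.prod_map_mul, Multiset.map_const', Multiset.prod_replicate, hcard,
    rootProduct, ← hF, ← hG, hswap, C_mul, C_pow, C_pow]
  ring

open Classical in
/-- The resultant product `f ⊠ g` of integral polynomials: for nonzero `f`, `g` it is the integral
polynomial `a ^ n * b ^ m * ∏ (X - αᵢ βⱼ)`, and it is `0` if one of the factors is `0`. -/
def resProd (f g : ℤ[X]) : ℤ[X] :=
  if f = 0 ∨ g = 0 then 0 else (exists_map_eq_rootProduct f g).choose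

lemma map_resProd {f g : ℤ[X]} (hf : f ≠ 0) (hg : g ≠ 0) :
    (resProd f g).map (Int.castRingHom ℂ) = rootProduct f g := by
  rw [resProd, if_neg (by simp [hf, hg])]
  exact (exists_map_eq_rootProduct f g).choose_spec

/-! ### Ultrapowers -/

/-- The ultrapower `*X` of `X` with respect to an ultrafilter on `ℕ`. -/
abbrev Star (𝔲 : Ultrafilter ℕ) (X : Type) : Type := Filter.Germ (𝔲 : Filter ℕ) X

variable {𝔲 : Ultrafilter ℕ}

/-- The inclusion `*ℕ ⊆ *ℝ`. -/
def natToReal (d : Star 𝔲 ℕ) : Star 𝔲 ℝ := Filter.Germ.map (fun n : ℕ => (n : ℝ)) d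

/-- The power `x ^ r = *{xᵢ ^ rᵢ}` of nonstandard reals; only used for `x ≥ 0`. -/
def starPow (x r : Star 𝔲 ℝ) : Star 𝔲 ℝ := Filter.Germ.map₂ (fun a b : ℝ => a ^ b) x r

/-- A nonstandard real is infinitesimal if its absolute value is below every positive real. -/
def IsInfinitesimal (x : Star 𝔲 ℝ) : Prop :=
  ∀ ε : ℝ, 0 < ε → |x| < ((ε : ℝ) : Star 𝔲 ℝ)

lemma abs_coe (u : ℕ → ℝ) : |(u : Star 𝔲 ℝ)| = ((fun n => |u n| : ℕ → ℝ) : Star 𝔲 ℝ) :=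
  Filter.Germ.abs_def _

lemma abs_le_const_iff (u : ℕ → ℝ) (M : ℝ) :
    |(u : Star 𝔲 ℝ)| ≤ ((M : ℝ) : Star 𝔲 ℝ) ↔ ∀ᶠ n in (𝔲 : Filter ℕ), |u n| ≤ M := by
  rw [abs_coe]; exact Iff.rfl

variable (𝔲) in
/-- The ring `*ℝ_fin` of bounded nonstandard reals, a valuation ring of `*ℝ`. -/
def Rfin : ValuationSubring (Star 𝔲 ℝ) where
  carrier := {x | ∃ M : ℝ, |x| ≤ ((M : ℝ) : Star 𝔲 ℝ)}
  mul_mem' := by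
    rintro x y ⟨M, hM⟩ ⟨N, hN⟩
    refine ⟨M * N, ?_⟩
    rw [abs_mul]
    exact mul_le_mul hM hN (abs_nonneg _) ((abs_nonneg _).trans hM)
  one_mem' := ⟨1, by rw [abs_one]; exact le_refl _⟩
  add_mem' := by
    rintro x y ⟨M, hM⟩ ⟨N, hN⟩
    exact ⟨M + N, (abs_add_le x y).trans (add_le_add hM hN)⟩
  zero_mem' := ⟨0, by rw [abs_zero]; exact le_refl _⟩
  neg_mem' := by
    rintro x ⟨M, hM⟩
    exact ⟨M, by rwa [abs_neg]⟩
  mem_or_inv_mem' := by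
    intro x
    rcases le_total |x| 1 with h | h
    · exact Or.inl ⟨1, h⟩
    · exact Or.inr ⟨1, by rw [abs_inv]; exact inv_le_one_of_one_le₀ h⟩

lemma mem_Rfin {x : Star 𝔲 ℝ} : x ∈ Rfin 𝔲 ↔ ∃ M : ℝ, |x| ≤ ((M : ℝ) : Star 𝔲 ℝ) := Iff.rfl

/-! ### The growth-decay semi-ring -/

variable (𝔲) in
/-- The growth-decay semi-ring `*ℝ / (*ℝ_fin)ˣ = (*ℝ_{>0} ∪ {0}) / (*ℝ_fin)ˣ_{>0}`: the value group
(with zero) of the bounded nonstandard reals. Its `0` is the class `-∞` of the nonstandard real `0`,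
its tropical sum is `max`. -/
abbrev GD : Type := (Rfin 𝔲).ValueGroup

/-- The growth-decay valuation `⟨x⟩`. -/
def gd (x : Star 𝔲 ℝ) : GD 𝔲 := (Rfin 𝔲).valuation x

lemma exists_gd_eq (μ : GD 𝔲) : ∃ x : Star 𝔲 ℝ, gd x = μ := (Rfin 𝔲).valuation_surjective μ

lemma gd_le_iff (x y : Star 𝔲 ℝ) :
    gd x ≤ gd y ↔ ∃ M : ℝ, |x| ≤ ((M : ℝ) : Star 𝔲 ℝ) * |y| := by
  rw [gd, gd, ValuationSubring.valuation_le_iff]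
  constructor
  · rintro ⟨⟨a, M, hM⟩, rfl⟩
    refine ⟨M, ?_⟩
    rw [abs_mul]
    exact mul_le_mul_of_nonneg_right hM (abs_nonneg _)
  · rintro ⟨M, hM⟩
    by_cases hy : y = 0
    · subst hy
      have : x = 0 := by simpa using hM
      exact ⟨0, by simp [this]⟩
    · have hy' : 0 < |y| := abs_pos.mpr hy
      refine ⟨⟨x / y, mem_Rfin.2 ⟨M, ?_⟩⟩, div_mul_cancel₀ x hy⟩
      rw [abs_div]
      exact (div_le_iff₀ hy').2 hM

/-- Powers with bounded nonnegative exponents are monotone up to bounded factors. -/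
lemma gd_pow_le {x y : Star 𝔲 ℝ} {r : Star 𝔲 ℝ} (hr : r ∈ Rfin 𝔲) (h : gd x = gd y) :
    gd (starPow |x| r) ≤ gd (starPow |y| r) := by
  obtain ⟨M, hM⟩ := (gd_le_iff x y).1 h.le
  obtain ⟨N, hN⟩ := (gd_le_iff y x).1 h.ge
  obtain ⟨K, hK⟩ := mem_Rfin.1 hr
  rw [gd_le_iff]
  induction x using Filter.Germ.inductionOn with | h x => ?_
  induction y using Filter.Germ.inductionOn with | h y => ?_
  induction r using Filter.Germ.inductionOn with | h r => ?_
  rw [abs_coe, abs_coe] at *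
  have hM' : ∀ᶠ n in (𝔲 : Filter ℕ), |x n| ≤ M * |y n| := hM
  have hN' : ∀ᶠ n in (𝔲 : Filter ℕ), |y n| ≤ N * |x n| := hN
  have hK' : ∀ᶠ n in (𝔲 : Filter ℕ), |r n| ≤ K := (abs_le_const_iff r K).1 hK
  set L := max 1 (max M N) with hL
  have hL1 : 1 ≤ L := le_max_left _ _
  refine ⟨L ^ K, ?_⟩
  change |((fun n => |x n| ^ r n : ℕ → ℝ) : Star 𝔲 ℝ)| ≤
    ((L ^ K : ℝ) : Star 𝔲 ℝ) * |((fun n => |y n| ^ r n : ℕ → ℝ) : Star 𝔲 ℝ)|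
  rw [abs_coe, abs_coe]
  change ∀ᶠ n in (𝔲 : Filter ℕ), |(|x n| ^ r n)| ≤ L ^ K * |(|y n| ^ r n)|
  filter_upwards [hM', hN', hK'] with n h1 h2 h3
  have hx0 := abs_nonneg (x n)
  have hy0 := abs_nonneg (y n)
  rw [abs_of_nonneg (Real.rpow_nonneg hx0 _), abs_of_nonneg (Real.rpow_nonneg hy0 _)]
  have h1' : |x n| ≤ L * |y n| := h1.trans
    (mul_le_mul_of_nonneg_right ((le_max_left M N).trans (le_max_right _ _)) hy0)
  have h2' : |y n| ≤ L * |x n| := h2.trans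
    (mul_le_mul_of_nonneg_right ((le_max_right M N).trans (le_max_right _ _)) hx0)
  have hK0 : 0 ≤ K := (abs_nonneg _).trans h3
  by_cases hx : |x n| = 0
  · have hy : |y n| = 0 := by
      rw [hx, mul_zero] at h2'
      exact le_antisymm h2' hy0
    rw [hx, hy]
    exact le_mul_of_one_le_left (Real.rpow_nonneg le_rfl _) (Real.one_le_rpow hL1 hK0)
  have hxp : 0 < |x n| := lt_of_le_of_ne hx0 (Ne.symm hx)
  have hyp : 0 < |y n| := by
    rcases hy0.lt_or_eq with h | h
    · exact h
    · rw [← h, mul_zero] at h1'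
      exact absurd (le_antisymm h1' hx0) hx
  have hLpos : 0 < L := lt_of_lt_of_le one_pos hL1
  rcases le_total 0 (r n) with hr0 | hr0
  · calc |x n| ^ r n ≤ (L * |y n|) ^ r n := Real.rpow_le_rpow hx0 h1' hr0
      _ = L ^ r n * |y n| ^ r n := Real.mul_rpow hLpos.le hy0
      _ ≤ L ^ K * |y n| ^ r n := mul_le_mul_of_nonneg_right
          (Real.rpow_le_rpow_of_exponent_le hL1 ((le_abs_self _).trans h3))
          (Real.rpow_nonneg hy0 _)
  · have h4 : (L * |x n|) ^ r n ≤ |y n| ^ r n := Real.rpow_le_rpow_of_nonpos hyp h2' hr0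
    rw [Real.mul_rpow hLpos.le hx0] at h4
    calc |x n| ^ r n = L ^ (-r n) * (L ^ r n * |x n| ^ r n) := by
          rw [← mul_assoc, ← Real.rpow_add hLpos]; simp
      _ ≤ L ^ (-r n) * |y n| ^ r n :=
          mul_le_mul_of_nonneg_left h4 (Real.rpow_nonneg hLpos.le _)
      _ ≤ L ^ K * |y n| ^ r n := mul_le_mul_of_nonneg_right
          (Real.rpow_le_rpow_of_exponent_le hL1 ((neg_le_abs _).trans h3))
          (Real.rpow_nonneg hy0 _)

/-- The Frobenius power `⟨x⟩ ^ r = ⟨|x| ^ r⟩` for a bounded exponent `r`; it does not depend on the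
representative `x`, see `frobPow_gd`. -/
def frobPow (μ : GD 𝔲) (r : Rfin 𝔲) : GD 𝔲 := gd (starPow |(exists_gd_eq μ).choose| r)

lemma frobPow_gd (x : Star 𝔲 ℝ) (r : Rfin 𝔲) : frobPow (gd x) r = gd (starPow |x| r) := by
  have h := (exists_gd_eq (gd x)).choose_spec
  exact le_antisymm (gd_pow_le r.2 h) (gd_pow_le r.2 h.symm)

/-- The bounded nonstandard real `1 / d` for a nonstandard natural number `d`. -/
def invNat (d : Star 𝔲 ℕ) : Rfin 𝔲 := ⟨(natToReal d)⁻¹, by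
  refine mem_Rfin.2 ⟨1, ?_⟩
  induction d using Filter.Germ.inductionOn with | h d => ?_
  change |((fun n => ((d n : ℝ))⁻¹ : ℕ → ℝ) : Star 𝔲 ℝ)| ≤ ((1 : ℝ) : Star 𝔲 ℝ)
  rw [abs_le_const_iff]
  refine Filter.Eventually.of_forall fun n => ?_
  rw [abs_of_nonneg (by positivity)]
  exact Nat.cast_inv_le_one _⟩

/-! ### Polynomials of possibly infinite degree -/

/-- The degree of a nonstandard polynomial; the zero polynomial has degree `0`. -/
def starDeg (f : Star 𝔲 ℤ[X]) : Star 𝔲 ℕ := Filter.Germ.map natDegree f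

/-- The value of a nonstandard polynomial at a standard real. -/
def starEval (θ : ℝ) (f : Star 𝔲 ℤ[X]) : Star 𝔲 ℝ := Filter.Germ.map (fun p : ℤ[X] => aeval θ p) f

/-- The height, the maximum of the absolute values of the coefficients. -/
def height (f : Star 𝔲 ℤ[X]) : Star 𝔲 ℝ := Filter.Germ.map (fun p : ℤ[X] => p.supNorm) f

/-- The Mahler measure. -/
def mahler (f : Star 𝔲 ℤ[X]) : Star 𝔲 ℝ :=
  Filter.Germ.map (fun p : ℤ[X] => (p.map (Int.castRingHom ℂ)).mahlerMeasure) f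

/-- The degree-normalized Mahler measure `𝔪_d(f) = 𝔪(f) ^ (1 / d)`. -/
def mahlerN (d : Star 𝔲 ℕ) (f : Star 𝔲 ℤ[X]) : Star 𝔲 ℝ := starPow (mahler f) (invNat d)

/-- The degree-normalized height `𝔥_d(f) = 𝔥(f) ^ (1 / d)`. -/
def heightN (d : Star 𝔲 ℕ) (f : Star 𝔲 ℤ[X]) : Star 𝔲 ℝ := starPow (height f) (invNat d)

/-- The normalized growth index `μ_d(f) = ⟨𝔥_d(f)⁻¹⟩` of a nonzero polynomial. -/
def growth (d : Star 𝔲 ℕ) (f : Star 𝔲 ℤ[X]) : GD 𝔲 := gd (heightN d f)⁻¹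

/-- The normalized decay `ν_d(f) = ⟨|f(θ)| ^ (1 / d)⟩` at `θ`. -/
def decay (d : Star 𝔲 ℕ) (θ : ℝ) (f : Star 𝔲 ℤ[X]) : GD 𝔲 :=
  gd (starPow |starEval θ f| (invNat d))

/-- The resultant product of nonstandard polynomials, `*{fᵢ} ⊠ *{gᵢ} = *{fᵢ ⊠ gᵢ}`. -/
def starResProd (f g : Star 𝔲 ℤ[X]) : Star 𝔲 ℤ[X] := Filter.Germ.map₂ resProd f g

/-- The nonstandard linear polynomial `a X - b`. -/
def linPoly (a b : Star 𝔲 ℤ) : Star 𝔲 ℤ[X] :=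
  Filter.Germ.map₂ (fun a b : ℤ => C a * X - C b) a b

/-- Polynomial approximations of `θ` of degree at most `d`. -/
def Approx (θ : ℝ) (d : Star 𝔲 ℕ) : Set (Star 𝔲 ℤ[X]) :=
  {f | starDeg f ≤ d ∧ IsInfinitesimal (starEval θ f)}

/-- Approximations with growth bound: `μ_d(f) > μ`. The zero polynomial, whose height `0` is smaller
than any bound, belongs to it. -/
def ApproxGrowth (μ : GD 𝔲) (θ : ℝ) (d : Star 𝔲 ℕ) : Set (Star 𝔲 ℤ[X]) :=
  {f | f ∈ Approx θ d ∧ (f = 0 ∨ μ < growth d f)}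

/-- Approximations with growth bound `μ_d(f) > μ` and decay bound `ν_d(f) ^ (1 / e) ≤ ν`
(formally, `ν_d(f) ≤ ν ^ e`, where `ν ^ e` need not make sense as `e` may be infinite). -/
def ApproxGrowthDecay (μ ν : GD 𝔲) (e : Star 𝔲 ℕ) (θ : ℝ) (d : Star 𝔲 ℕ) : Set (Star 𝔲 ℤ[X]) :=
  {f | f ∈ ApproxGrowth μ θ d ∧ frobPow (decay d θ f) (invNat e) ≤ ν}

end PolyApprox

end

/-!
The product `(f ⊠ g)(θη)` has the factors `θη - αβ = (θ - α)η + α(η - β)`, one for each pair of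
roots. Measured relative to `max 1 ‖α‖` and `max 1 ‖β‖`, the distances `‖θ - α‖` and `‖η - β‖`
become bounded numbers `x_α` and `y_β`, which may be scaled to lie in `[0, 1]`, and a factor is
at most `C * max 1 ‖α‖ * max 1 ‖β‖ * max x_α y_β` with `C` depending on `θ` and `η` only
(`norm_mul_sub_mul_le`). If the smallest of all the `x_α` and `y_β` is an `x_α`, the pairs that
contain this `α` contribute `∏ y_β` to the product of the maxima and all other pairs at most
`1`; hence `∏ max x_α y_β ≤ max (∏ x_α) (∏ y_β)` (`prod_prod_max_le`). Here `∏ x_α` is, up to a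
factor at most `1`, `|f(θ)|` divided by the Mahler measure of `f`. This gives, with `M` the
Mahler measure and for `f`, `g` of positive degrees `m`, `n`, `|(f ⊠ g)(θη)| ≤ C ^ (m * n) * max
(M f ^ (n - 1) * M g ^ m * |f(θ)|) (M f ^ n * M g ^ (m - 1) * |g(η)|)` (`abs_aeval_resProd_le`).
As `M ≥ 1` for nonzero integral polynomials, `m` and `n` may be replaced by the bounds `d` and
`e` of the degrees, and the `(d * e)`-th root turns the constant into a bounded one, whatever
`d` and `e` are.

For the growth, `M (f ⊠ g) ≤ M f ^ n * M g ^ m` is read off from the roots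
(`intMahler_resProd_le`), and the height differs from the Mahler measure by a factor between `2
^ (-d)` and `2 ^ d`, which the `d`-th root makes bounded (`gd_heightN_eq`). Bilinearity holds
because the roots of a product are those of the factors together, with multiplicity.
-/

noncomputable section

namespace PolyApprox

/-! ### Products over pairs of roots -/

lemma prod_prod_map_mul {α β : Type*} (s : Multiset α) (t : Multiset β) (u : α → ℝ) (v : β → ℝ) :
    (s.map fun a => (t.map fun b => u a * v b).prod).prod =
      (s.map u).prod ^ Multiset.card t * (t.map v).prod ^ Multiset.card s := by
  have h : ∀ a, (t.map fun b => u a * v b).prod = u a ^ Multiset.card t * (t.map v).prod := by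
    intro a
    rw [Multiset.prod_map_mul, Multiset.map_const', Multiset.prod_replicate]
  simp only [h]
  rw [Multiset.prod_map_mul, Multiset.prod_map_pow, Multiset.map_const', Multiset.prod_replicate]

lemma prod_map_nonneg_of_nonneg {β : Type*} (t : Multiset β) {u : β → ℝ} (hu : ∀ b, 0 ≤ u b) :
    0 ≤ (t.map u).prod :=
  Multiset.prod_nonneg fun x hx => by
    obtain ⟨b, -, rfl⟩ := Multiset.mem_map.1 hx
    exact hu b

lemma prod_prod_map_le {α β : Type*} (s : Multiset α) (t : Multiset β) {u v : α → β → ℝ}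
    (hu : ∀ a b, 0 ≤ u a b) (h : ∀ a b, u a b ≤ v a b) :
    (s.map fun a => (t.map fun b => u a b).prod).prod ≤
      (s.map fun a => (t.map fun b => v a b).prod).prod :=
  Multiset.prod_map_le_prod_map₀ _ _ (fun a _ => prod_map_nonneg_of_nonneg t (hu a))
    fun a _ => Multiset.prod_map_le_prod_map₀ _ _ (fun b _ => hu a b) fun b _ => h a b

/-- A row whose entry `x a` lies below all the `y b` contributes `∏ y b`, and the other rows
contribute factors at most `1`. -/
lemma prod_prod_max_le_of_le {α β : Type*} {s : Multiset α} {t : Multiset β} {x : α → ℝ}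
    {y : β → ℝ} (hx : ∀ a, 0 ≤ x a) (hx1 : ∀ a, x a ≤ 1) (hy : ∀ b, 0 ≤ y b) (hy1 : ∀ b, y b ≤ 1)
    {a : α} (ha : a ∈ s) (hat : ∀ b ∈ t, x a ≤ y b) :
    (s.map fun a => (t.map fun b => max (x a) (y b)).prod).prod ≤ (t.map y).prod := by
  obtain ⟨s', rfl⟩ := Multiset.exists_cons_of_mem ha
  have h0 : ∀ a b, 0 ≤ max (x a) (y b) := fun a b => (hx a).trans (le_max_left _ _)
  rw [Multiset.map_cons, Multiset.prod_cons]
  have h1 : (t.map fun b => max (x a) (y b)).prod = (t.map y).prod := by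
    congr 1
    exact Multiset.map_congr rfl fun b hb => max_eq_right (hat b hb)
  rw [h1]
  refine mul_le_of_le_one_right (prod_map_nonneg_of_nonneg t hy) ?_
  refine (prod_prod_map_le s' t (v := fun _ _ => 1) h0 fun a b => max_le (hx1 a) (hy1 b)).trans ?_
  simp

/-- If the smallest of all the numbers `x a` and `y b` is some `x a`, then the product over all
pairs is at most `∏ y b`, and conversely. -/
lemma prod_prod_max_le {α β : Type*} {s : Multiset α} {t : Multiset β} {x : α → ℝ}
    {y : β → ℝ} (hx : ∀ a, 0 ≤ x a) (hx1 : ∀ a, x a ≤ 1) (hy : ∀ b, 0 ≤ y b) (hy1 : ∀ b, y b ≤ 1)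
    (hs : s ≠ 0) (ht : t ≠ 0) :
    (s.map fun a => (t.map fun b => max (x a) (y b)).prod).prod ≤
      max (s.map x).prod (t.map y).prod := by
  classical
  obtain ⟨a, ha, hmin⟩ := s.toFinset.exists_min_image x (Multiset.toFinset_nonempty.2 hs)
  obtain ⟨b, hb, hmin'⟩ := t.toFinset.exists_min_image y (Multiset.toFinset_nonempty.2 ht)
  simp only [Multiset.mem_toFinset] at ha hb hmin hmin'
  rcases le_total (x a) (y b) with h | h
  · exact (prod_prod_max_le_of_le hx hx1 hy hy1 ha fun b hb => h.trans (hmin' b hb)).trans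
      (le_max_right _ _)
  · rw [Multiset.prod_map_prod_map]
    simp only [max_comm (x _)]
    exact (prod_prod_max_le_of_le hy hy1 hx hx1 hb fun a ha => h.trans (hmin a ha)).trans
      (le_max_left _ _)

/-! ### Algebra of the resultant product -/

/-- The multiset of complex roots. -/
abbrev cRoots (f : ℤ[X]) : Multiset ℂ := (f.map (Int.castRingHom ℂ)).roots

/-- The Mahler measure of an integral polynomial. -/
abbrev intMahler (f : ℤ[X]) : ℝ := (f.map (Int.castRingHom ℂ)).mahlerMeasure

lemma map_intCast_injective : Function.Injective (Polynomial.map (Int.castRingHom ℂ)) :=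
  map_injective _ (RingHom.injective_int _)

lemma card_cRoots (f : ℤ[X]) : Multiset.card (cRoots f) = f.natDegree := by
  rw [← (IsAlgClosed.splits _).natDegree_eq_card_roots,
    natDegree_map_eq_of_injective (RingHom.injective_int _)]

lemma leadingCoeff_map_intCast (f : ℤ[X]) :
    (f.map (Int.castRingHom ℂ)).leadingCoeff = (f.leadingCoeff : ℂ) := by
  rw [leadingCoeff_map_of_injective (RingHom.injective_int _)]; simp

lemma rootProduct_eq (f g : ℤ[X]) :
    rootProduct f g =
      C ((f.leadingCoeff : ℂ) ^ g.natDegree * (g.leadingCoeff : ℂ) ^ f.natDegree) *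
        ((cRoots f).map fun a => ((cRoots g).map fun b => X - C (a * b)).prod).prod := by
  rw [rootProduct, Multiset.prod_map_product_eq_prod_prod]

@[simp] lemma resProd_zero_left (g : ℤ[X]) : resProd 0 g = 0 := by simp [resProd]

@[simp] lemma resProd_zero_right (f : ℤ[X]) : resProd f 0 = 0 := by simp [resProd]

lemma resProd_comm (f g : ℤ[X]) : resProd f g = resProd g f := by
  by_cases hf : f = 0
  · simp [hf]
  by_cases hg : g = 0
  · simp [hg]
  apply map_intCast_injective
  rw [map_resProd hf hg, map_resProd hg hf, rootProduct_eq, rootProduct_eq,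
    Multiset.prod_map_prod_map, mul_comm ((f.leadingCoeff : ℂ) ^ _)]
  simp only [mul_comm]

lemma resProd_mul_left (f f' g : ℤ[X]) :
    resProd (f * f') g = resProd f g * resProd f' g := by
  by_cases hf : f = 0
  · simp [hf]
  by_cases hf' : f' = 0
  · simp [hf']
  by_cases hg : g = 0
  · simp [hg]
  have hr : cRoots (f * f') = cRoots f + cRoots f' := by
    rw [cRoots, Polynomial.map_mul, roots_mul]
    rw [← Polynomial.map_mul]
    exact (Polynomial.map_ne_zero_iff (RingHom.injective_int _)).2 (mul_ne_zero hf hf')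
  apply map_intCast_injective
  rw [Polynomial.map_mul, map_resProd (mul_ne_zero hf hf') hg, map_resProd hf hg,
    map_resProd hf' hg, rootProduct_eq, rootProduct_eq, rootProduct_eq, hr, Multiset.map_add,
    Multiset.prod_add, leadingCoeff_mul, natDegree_mul hf hf']
  push_cast
  simp only [mul_pow, pow_add, C_mul]
  ring

lemma resProd_mul_right (f g g' : ℤ[X]) :
    resProd f (g * g') = resProd f g * resProd f g' := by
  rw [resProd_comm, resProd_mul_left, resProd_comm g, resProd_comm g']

lemma resProd_linear {a a' : ℤ} (b b' : ℤ) (ha : a ≠ 0) (ha' : a' ≠ 0) :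
    resProd (C a * X - C b) (C a' * X - C b') = C (a * a') * X - C (b * b') := by
  have key : ∀ {a : ℤ} (b : ℤ), a ≠ 0 → (C a * X - C b : ℤ[X]).natDegree = 1 ∧
      (C a * X - C b : ℤ[X]).leadingCoeff = a ∧ (C a * X - C b : ℤ[X]) ≠ 0 ∧
      cRoots (C a * X - C b) = {(a : ℂ)⁻¹ * b} := by
    intro a b ha
    have h := natDegree_linear (b := -b) ha
    have h' := leadingCoeff_linear (b := -b) ha
    rw [C_neg, ← sub_eq_add_neg] at h h'
    refine ⟨h, h', ?_, ?_⟩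
    · rintro h0
      rw [h0] at h
      simp at h
    · have ha' : (a : ℂ) ≠ 0 := by exact_mod_cast ha
      rw [cRoots]
      simpa [sub_eq_add_neg] using roots_C_mul_X_add_C (a := (a : ℂ)) (-b : ℂ) ha'
  obtain ⟨h1, h2, h3, h4⟩ := key b ha
  obtain ⟨h1', h2', h3', h4'⟩ := key b' ha'
  have hc : (a : ℂ) ≠ 0 := by exact_mod_cast ha
  have hc' : (a' : ℂ) ≠ 0 := by exact_mod_cast ha'
  apply map_intCast_injective
  rw [map_resProd h3 h3', rootProduct_eq, h1, h2, h4, h1', h2', h4']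
  simp only [Multiset.map_singleton, Multiset.prod_singleton, pow_one, mul_sub, ← C_mul,
    Polynomial.map_sub, Polynomial.map_mul, map_X, eq_intCast]
  have : (a : ℂ) * a' * ((a : ℂ)⁻¹ * b * ((a' : ℂ)⁻¹ * b')) = b * b' := by field_simp
  rw [this]
  push_cast
  simp

/-! ### Degree, Mahler measure and values of the resultant product -/

lemma natDegree_resProd_le (f g : ℤ[X]) :
    (resProd f g).natDegree ≤ f.natDegree * g.natDegree := by
  by_cases hf : f = 0
  · simp [hf]
  by_cases hg : g = 0
  · simp [hg]
  rw [← natDegree_map_eq_of_injective (RingHom.injective_int (Int.castRingHom ℂ)),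
    map_resProd hf hg, rootProduct]
  refine (natDegree_C_mul_le _ _).trans ?_
  rw [natDegree_multiset_prod_of_monic]
  · rw [Multiset.map_map]
    simp only [Function.comp_def, natDegree_X_sub_C]
    simp [card_cRoots]
  · simp only [Multiset.mem_map]
    rintro _ ⟨p, -, rfl⟩
    exact monic_X_sub_C _

lemma one_le_intMahler {f : ℤ[X]} (hf : f ≠ 0) : 1 ≤ intMahler f :=
  one_le_mahlerMeasure_of_ne_zero hf

lemma intMahler_eq (f : ℤ[X]) :
    intMahler f = ‖(f.leadingCoeff : ℂ)‖ * ((cRoots f).map fun a => max 1 ‖a‖).prod := by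
  rw [intMahler, mahlerMeasure_eq_leadingCoeff_mul_prod_roots, leadingCoeff_map_intCast]

lemma intMahler_resProd_le {f g : ℤ[X]} (hf : f ≠ 0) (hg : g ≠ 0) :
    intMahler (resProd f g) ≤ intMahler f ^ g.natDegree * intMahler g ^ f.natDegree := by
  have h : ((cRoots f).map fun a => ((cRoots g).map fun b => X - C (a * b)).prod).prod.mahlerMeasure
      = ((cRoots f).map fun a => ((cRoots g).map fun b => max 1 ‖a * b‖).prod).prod := by
    simp only [prod_mahlerMeasure_eq_mahlerMeasure_prod, Multiset.map_map, Function.comp_def,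
      mahlerMeasure_X_sub_C]
  rw [intMahler, map_resProd hf hg, rootProduct_eq, mahlerMeasure_mul, mahlerMeasure_const, h,
    intMahler_eq, intMahler_eq, norm_mul, norm_pow, norm_pow]
  have h2 : ((cRoots f).map fun a => ((cRoots g).map fun b => max 1 ‖a * b‖).prod).prod ≤
      ((cRoots f).map fun a => ((cRoots g).map fun b => max 1 ‖a‖ * max 1 ‖b‖).prod).prod := by
    refine prod_prod_map_le _ _ (fun a b => by positivity) fun a b => max_le ?_ ?_
    · exact one_le_mul_of_one_le_of_one_le (le_max_left _ _) (le_max_left _ _)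
    · rw [norm_mul]
      exact mul_le_mul (le_max_right _ _) (le_max_right _ _) (norm_nonneg _) (by positivity)
  rw [prod_prod_map_mul, card_cRoots, card_cRoots] at h2
  refine (mul_le_mul_of_nonneg_left h2 (by positivity)).trans (le_of_eq ?_)
  ring

lemma norm_multiset_prod (s : Multiset ℂ) : ‖s.prod‖ = (s.map fun z => ‖z‖).prod :=
  map_multiset_prod (normHom (α := ℂ)) s

lemma norm_eval_map_intCast (f : ℤ[X]) (θ : ℝ) :
    ‖(f.map (Int.castRingHom ℂ)).eval (θ : ℂ)‖ = |aeval θ f| := by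
  have : (f.map (Int.castRingHom ℂ)).eval (θ : ℂ) = ((aeval θ f : ℝ) : ℂ) := by
    rw [eval_map, ← Complex.coe_algebraMap, ← aeval_algebraMap_apply, aeval_def]
    rfl
  rw [this, Complex.norm_real, Real.norm_eq_abs]

lemma abs_aeval_eq (f : ℤ[X]) (θ : ℝ) :
    |aeval θ f| = ‖(f.leadingCoeff : ℂ)‖ * ((cRoots f).map fun a => ‖(θ : ℂ) - a‖).prod := by
  rw [← norm_eval_map_intCast]
  conv_lhs => rw [(IsAlgClosed.splits (f.map (Int.castRingHom ℂ))).eq_prod_roots]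
  rw [eval_mul, eval_C, norm_mul, leadingCoeff_map_intCast, eval_multiset_prod,
    norm_multiset_prod, Multiset.map_map, Multiset.map_map]
  simp [Function.comp_def]

lemma abs_aeval_resProd_eq {f g : ℤ[X]} (hf : f ≠ 0) (hg : g ≠ 0) (x : ℝ) :
    |aeval x (resProd f g)| =
      ‖(f.leadingCoeff : ℂ)‖ ^ g.natDegree * ‖(g.leadingCoeff : ℂ)‖ ^ f.natDegree *
        ((cRoots f).map fun a => ((cRoots g).map fun b => ‖(x : ℂ) - a * b‖).prod).prod := by
  rw [← norm_eval_map_intCast, map_resProd hf hg, rootProduct_eq, eval_mul, eval_C, norm_mul,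
    norm_mul, norm_pow, norm_pow]
  congr 1
  rw [eval_multiset_prod, norm_multiset_prod, Multiset.map_map, Multiset.map_map]
  congr 1
  refine Multiset.map_congr rfl fun a _ => ?_
  simp only [Function.comp_apply]
  rw [eval_multiset_prod, norm_multiset_prod, Multiset.map_map, Multiset.map_map]
  congr 1
  refine Multiset.map_congr rfl fun b _ => ?_
  simp

/-- The distance from `θ` to `a`, divided by `(1 + |θ|) * max 1 ‖a‖` to lie in `[0, 1]`. The
factor `max 1 ‖a‖` is the contribution of the root `a` to the Mahler measure. -/
def relDist (θ : ℝ) (a : ℂ) : ℝ := ‖(θ : ℂ) - a‖ / ((1 + |θ|) * max 1 ‖a‖)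

lemma relDist_nonneg (θ : ℝ) (a : ℂ) : 0 ≤ relDist θ a := by
  unfold relDist; positivity

lemma relDist_le_one (θ : ℝ) (a : ℂ) : relDist θ a ≤ 1 := by
  refine div_le_one_of_le₀ ((norm_sub_le _ _).trans ?_) (by positivity)
  rw [Complex.norm_real, Real.norm_eq_abs]
  nlinarith [abs_nonneg θ, le_max_left 1 ‖a‖, le_max_right 1 ‖a‖]

lemma norm_sub_eq_relDist (θ : ℝ) (a : ℂ) :
    ‖(θ : ℂ) - a‖ = (1 + |θ|) * max 1 ‖a‖ * relDist θ a := by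
  unfold relDist
  field_simp

/-- Follows from `θη - ab = (θ - a)η + a(η - b)`. -/
lemma norm_mul_sub_mul_le (θ η : ℝ) (a b : ℂ) :
    ‖((θ * η : ℝ) : ℂ) - a * b‖ ≤
      (2 * (1 + |θ|) * (1 + |η|) * max 1 ‖a‖) * max 1 ‖b‖ * max (relDist θ a) (relDist η b) := by
  have h : ((θ * η : ℝ) : ℂ) - a * b = (θ - a) * η + a * (η - b) := by push_cast; ring
  have hA := le_max_left 1 ‖a‖
  have hA' := le_max_right 1 ‖a‖
  have hB := le_max_left 1 ‖b‖
  set A := max 1 ‖a‖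
  set B := max 1 ‖b‖
  set z := max (relDist θ a) (relDist η b) with hz
  have hz0 : 0 ≤ z := (relDist_nonneg θ a).trans (le_max_left _ _)
  have hθ := abs_nonneg θ
  have hη := abs_nonneg η
  have h1 : ‖(θ : ℂ) - a‖ * |η| ≤ (1 + |θ|) * A * z * ((1 + |η|) * B) := by
    rw [norm_sub_eq_relDist]
    refine mul_le_mul (mul_le_mul_of_nonneg_left (le_max_left _ _) (by positivity)) ?_ hη
      (by positivity)
    nlinarith
  have h2 : ‖a‖ * ‖(η : ℂ) - b‖ ≤ (A * (1 + |θ|)) * ((1 + |η|) * B * z) := by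
    rw [norm_sub_eq_relDist η]
    refine mul_le_mul (by nlinarith) (mul_le_mul_of_nonneg_left (le_max_right _ _) (by positivity))
      (mul_nonneg (by positivity) (relDist_nonneg _ _)) (by positivity)
  rw [h]
  refine (norm_add_le _ _).trans ?_
  rw [norm_mul, norm_mul, Complex.norm_real η, Real.norm_eq_abs]
  linarith

/-- The constant factor in the estimate of the linear factors of `(f ⊠ g)(θη)`. -/
def pairConst (θ η : ℝ) : ℝ := 2 * (1 + |θ|) * (1 + |η|)

lemma one_le_pairConst (θ η : ℝ) : 1 ≤ pairConst θ η := by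
  unfold pairConst
  nlinarith [abs_nonneg θ, abs_nonneg η, mul_nonneg (abs_nonneg θ) (abs_nonneg η)]

lemma prod_relDist_le {f : ℤ[X]} (hf : f ≠ 0) (θ : ℝ) :
    ((cRoots f).map (relDist θ)).prod ≤ |aeval θ f| / intMahler f := by
  have hM : 0 < intMahler f := one_pos.trans_le (one_le_intMahler hf)
  have h0 : 0 ≤ ((cRoots f).map (relDist θ)).prod :=
    prod_map_nonneg_of_nonneg _ (relDist_nonneg θ)
  rw [le_div_iff₀ hM, abs_aeval_eq, intMahler_eq]
  simp only [norm_sub_eq_relDist]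
  rw [Multiset.prod_map_mul, Multiset.prod_map_mul, Multiset.map_const', Multiset.prod_replicate]
  have h1 : 1 ≤ (1 + |θ|) ^ Multiset.card (cRoots f) :=
    one_le_pow₀ (le_add_of_nonneg_right (abs_nonneg _))
  have h2 : 0 ≤ ((cRoots f).map (relDist θ)).prod *
      (‖(f.leadingCoeff : ℂ)‖ * ((cRoots f).map fun a => max 1 ‖a‖).prod) :=
    mul_nonneg h0 (by rw [← intMahler_eq]; exact hM.le)
  nlinarith

/-- The decay estimate for integral polynomials: a small value of `f` at `θ` and of `g` at `η`
forces a small value of `f ⊠ g` at `θη`. Both degrees must be positive, since the root with the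
smallest relative distance is paired with all the roots of the other polynomial. -/
lemma abs_aeval_resProd_le {f g : ℤ[X]} (hf : f.natDegree ≠ 0) (hg : g.natDegree ≠ 0) (θ η : ℝ) :
    |aeval (θ * η) (resProd f g)| ≤ pairConst θ η ^ (f.natDegree * g.natDegree) *
      (intMahler f ^ g.natDegree * intMahler g ^ f.natDegree) *
        max (|aeval θ f| / intMahler f) (|aeval η g| / intMahler g) := by
  have hf0 : f ≠ 0 := by rintro rfl; simp at hf
  have hg0 : g ≠ 0 := by rintro rfl; simp at hg
  have hfr : cRoots f ≠ 0 := by rwa [← Multiset.card_pos, card_cRoots, Nat.pos_iff_ne_zero]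
  have hgr : cRoots g ≠ 0 := by rwa [← Multiset.card_pos, card_cRoots, Nat.pos_iff_ne_zero]
  have hC := one_pos.trans_le (one_le_pairConst θ η)
  have h1 : ((cRoots f).map fun a => ((cRoots g).map fun b =>
      ‖((θ * η : ℝ) : ℂ) - a * b‖).prod).prod ≤ ((cRoots f).map fun a => ((cRoots g).map fun b =>
        ((pairConst θ η * max 1 ‖a‖) * max 1 ‖b‖) * max (relDist θ a) (relDist η b)).prod).prod :=
    prod_prod_map_le _ _ (fun _ _ => norm_nonneg _) fun a b => norm_mul_sub_mul_le θ η a b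
  have h2 : ((cRoots f).map fun a => ((cRoots g).map fun b =>
        ((pairConst θ η * max 1 ‖a‖) * max 1 ‖b‖) * max (relDist θ a) (relDist η b)).prod).prod =
      (pairConst θ η ^ f.natDegree * ((cRoots f).map fun a => max 1 ‖a‖).prod) ^ g.natDegree *
        ((cRoots g).map fun b => max 1 ‖b‖).prod ^ f.natDegree *
      ((cRoots f).map fun a => ((cRoots g).map fun b =>
        max (relDist θ a) (relDist η b)).prod).prod := by
    simp only [Multiset.prod_map_mul (f := fun b : ℂ => _ * max 1 ‖b‖)]
    rw [Multiset.prod_map_mul, prod_prod_map_mul, Multiset.prod_map_mul, Multiset.map_const',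
      Multiset.prod_replicate, card_cRoots, card_cRoots]
  have h3 : ((cRoots f).map fun a => ((cRoots g).map fun b =>
        max (relDist θ a) (relDist η b)).prod).prod ≤
      max (|aeval θ f| / intMahler f) (|aeval η g| / intMahler g) :=
    (prod_prod_max_le (relDist_nonneg θ) (relDist_le_one θ) (relDist_nonneg η) (relDist_le_one η)
      hfr hgr).trans (max_le_max (prod_relDist_le hf0 θ) (prod_relDist_le hg0 η))
  have hpos : ∀ s : Multiset ℂ, 0 ≤ (s.map fun a => max 1 ‖a‖).prod := fun s =>
    prod_map_nonneg_of_nonneg s fun a => by positivity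
  have hpf := hpos (cRoots f)
  have hpg := hpos (cRoots g)
  rw [abs_aeval_resProd_eq hf0 hg0]
  rw [h2] at h1
  refine (mul_le_mul_of_nonneg_left (h1.trans (mul_le_mul_of_nonneg_left h3 (by positivity)))
    (by positivity)).trans (le_of_eq ?_)
  rw [intMahler_eq f, intMahler_eq g]
  ring

/-! ### Normalized estimates for integral polynomials -/

lemma eq_zero_of_abs_aeval_lt_one {f : ℤ[X]} {θ : ℝ} (h : |aeval θ f| < 1)
    (hf : f.natDegree = 0) : f = 0 := by
  rw [eq_C_of_natDegree_eq_zero hf] at h ⊢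
  rw [aeval_C, eq_intCast] at h
  have h' : |f.coeff 0| < 1 := by exact_mod_cast h
  rw [Int.abs_lt_one_iff.1 h', C_0]

lemma pow_mul_rpow_inv {a : ℝ} (ha : 0 ≤ a) {d e : ℕ} (he : e ≠ 0) :
    (a ^ e) ^ (((d * e : ℕ) : ℝ)⁻¹) = a ^ (d : ℝ)⁻¹ := by
  have he' : (e : ℝ) ≠ 0 := by exact_mod_cast he
  rw [← Real.rpow_natCast, ← Real.rpow_mul ha]
  congr 1
  push_cast
  field_simp

/-- The `(d * e)`-th root of an estimate `R ≤ C ^ (d * e) * F ^ (e - 1) * G ^ d * x`; the factor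
`C ^ (d * e)` becomes the constant `C`, independent of the degrees. -/
lemma rpow_inv_le_of_le {d e : ℕ} (hd : d ≠ 0) (he : e ≠ 0) {C F G x R : ℝ} (hC : 0 ≤ C)
    (hF : 0 < F) (hG : 0 ≤ G) (hx : 0 ≤ x) (hR : 0 ≤ R)
    (h : R ≤ C ^ (d * e) * (F ^ e * G ^ d) * (x / F)) :
    R ^ (((d * e : ℕ) : ℝ)⁻¹) ≤
      C * ((F ^ (d : ℝ)⁻¹) ^ (1 - (e : ℝ)⁻¹) * G ^ (e : ℝ)⁻¹ * (x ^ (d : ℝ)⁻¹) ^ (e : ℝ)⁻¹) := by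
  have hde : d * e ≠ 0 := mul_ne_zero hd he
  refine (Real.rpow_le_rpow hR h (by positivity)).trans (le_of_eq ?_)
  rw [Real.mul_rpow (by positivity) (by positivity), Real.mul_rpow (by positivity) (by positivity),
    Real.mul_rpow (by positivity) (by positivity), Real.div_rpow hx hF.le,
    Real.pow_rpow_inv_natCast hC hde, pow_mul_rpow_inv hF.le he, mul_comm d e,
    pow_mul_rpow_inv hG hd, ← Real.rpow_mul hF.le, ← Real.rpow_mul hx, mul_sub, mul_one,
    Real.rpow_sub hF, ← mul_inv, mul_comm e d]
  push_cast
  ring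

/-- The decay estimate after taking `(d * e)`-th roots. An integral polynomial with a value of
absolute value below `1` is zero or nonconstant, so that `abs_aeval_resProd_le` applies unless a
factor vanishes. The bound by a maximum is stated as an alternative. -/
lemma rpow_abs_aeval_resProd_le {f g : ℤ[X]} {θ η : ℝ} {d e : ℕ} (hd : d ≠ 0) (he : e ≠ 0)
    (hf : f.natDegree ≤ d) (hg : g.natDegree ≤ e) (hfθ : |aeval θ f| < 1) (hgη : |aeval η g| < 1) :
    |aeval (θ * η) (resProd f g)| ^ (((d * e : ℕ) : ℝ)⁻¹) ≤ pairConst θ η *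
        ((intMahler f ^ (d : ℝ)⁻¹) ^ (1 - (e : ℝ)⁻¹) * intMahler g ^ (e : ℝ)⁻¹ *
          (|aeval θ f| ^ (d : ℝ)⁻¹) ^ (e : ℝ)⁻¹) ∨
      |aeval (θ * η) (resProd f g)| ^ (((d * e : ℕ) : ℝ)⁻¹) ≤ pairConst θ η *
        (intMahler f ^ (d : ℝ)⁻¹ * (intMahler g ^ (e : ℝ)⁻¹) ^ (1 - (d : ℝ)⁻¹) *
          (|aeval η g| ^ (e : ℝ)⁻¹) ^ (d : ℝ)⁻¹) := by
  have hC := one_le_pairConst θ η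
  have hF0 : 0 ≤ intMahler f := mahlerMeasure_nonneg _
  have hG0 : 0 ≤ intMahler g := mahlerMeasure_nonneg _
  by_cases h0 : f = 0 ∨ g = 0
  · left
    have : resProd f g = 0 := by rcases h0 with rfl | rfl <;> simp
    have hde : (((d * e : ℕ) : ℝ)⁻¹) ≠ 0 :=
      inv_ne_zero (Nat.cast_ne_zero.2 (mul_ne_zero hd he))
    -- the root of `0` is `0` because the exponent is not `0` (recall `0 ^ 0 = 1`)
    rw [this, map_zero, abs_zero, Real.zero_rpow hde]
    positivity
  obtain ⟨hf0, hg0⟩ := not_or.1 h0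
  have hF := one_le_intMahler hf0
  have hG := one_le_intMahler hg0
  have key := abs_aeval_resProd_le (fun h => hf0 (eq_zero_of_abs_aeval_lt_one hfθ h))
    (fun h => hg0 (eq_zero_of_abs_aeval_lt_one hgη h)) θ η
  have key' : |aeval (θ * η) (resProd f g)| ≤ pairConst θ η ^ (d * e) *
      (intMahler f ^ e * intMahler g ^ d) *
        max (|aeval θ f| / intMahler f) (|aeval η g| / intMahler g) := by
    refine key.trans (mul_le_mul_of_nonneg_right ?_ (le_max_of_le_left (by positivity)))
    have h1 : pairConst θ η ^ (f.natDegree * g.natDegree) ≤ pairConst θ η ^ (d * e) :=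
      pow_le_pow_right₀ hC (Nat.mul_le_mul hf hg)
    have h2 : intMahler f ^ g.natDegree ≤ intMahler f ^ e := pow_le_pow_right₀ hF hg
    have h3 : intMahler g ^ f.natDegree ≤ intMahler g ^ d := pow_le_pow_right₀ hG hf
    gcongr
  rcases le_total (|aeval θ f| / intMahler f) (|aeval η g| / intMahler g) with h | h
  · right
    rw [max_eq_right h, mul_comm d e, mul_comm (intMahler f ^ e)] at key'
    have := rpow_inv_le_of_le he hd (by positivity) (by positivity) (by positivity)
      (abs_nonneg _) (abs_nonneg _) key'
    rwa [mul_comm e d, mul_comm ((intMahler g ^ (e : ℝ)⁻¹) ^ (1 - (d : ℝ)⁻¹))] at this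
  · left
    rw [max_eq_left h] at key'
    exact rpow_inv_le_of_le hd he (by positivity) (by positivity) (by positivity)
      (abs_nonneg _) (abs_nonneg _) key'

lemma rpow_intMahler_resProd_le {f g : ℤ[X]} {d e : ℕ} (hd : d ≠ 0) (he : e ≠ 0)
    (hf : f.natDegree ≤ d) (hg : g.natDegree ≤ e) :
    intMahler (resProd f g) ^ (((d * e : ℕ) : ℝ)⁻¹) ≤
      intMahler f ^ (d : ℝ)⁻¹ * intMahler g ^ (e : ℝ)⁻¹ := by
  have hF0 : 0 ≤ intMahler f := mahlerMeasure_nonneg _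
  have hG0 : 0 ≤ intMahler g := mahlerMeasure_nonneg _
  by_cases h0 : f = 0 ∨ g = 0
  · have : intMahler (resProd f g) = 0 := by rcases h0 with rfl | rfl <;> simp
    have hde : (((d * e : ℕ) : ℝ)⁻¹) ≠ 0 :=
      inv_ne_zero (Nat.cast_ne_zero.2 (mul_ne_zero hd he))
    rw [this, Real.zero_rpow hde]
    positivity
  obtain ⟨hf0, hg0⟩ := not_or.1 h0
  have h2 : intMahler f ^ g.natDegree ≤ intMahler f ^ e :=
    pow_le_pow_right₀ (one_le_intMahler hf0) hg
  have h3 : intMahler g ^ f.natDegree ≤ intMahler g ^ d :=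
    pow_le_pow_right₀ (one_le_intMahler hg0) hf
  have h : intMahler (resProd f g) ≤ intMahler f ^ e * intMahler g ^ d :=
    (intMahler_resProd_le hf0 hg0).trans (by gcongr)
  refine (Real.rpow_le_rpow (mahlerMeasure_nonneg _) h (by positivity)).trans (le_of_eq ?_)
  rw [Real.mul_rpow (by positivity) (by positivity), pow_mul_rpow_inv hF0 he, mul_comm d e,
    pow_mul_rpow_inv hG0 hd]

lemma supNorm_map_intCast (f : ℤ[X]) : (f.map (Int.castRingHom ℂ)).supNorm = f.supNorm := by
  simp [supNorm_eq_iSup, Int.norm_eq_abs]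

lemma supNorm_le_two_pow_mul_intMahler {f : ℤ[X]} {d : ℕ} (hf : f.natDegree ≤ d) :
    f.supNorm ≤ 2 ^ d * intMahler f := by
  rw [← supNorm_map_intCast]
  refine (supNorm_le_choose_natDegree_div_two_mul_mahlerMeasure _).trans
    (mul_le_mul_of_nonneg_right ?_ (mahlerMeasure_nonneg _))
  rw [natDegree_map_eq_of_injective (RingHom.injective_int _)]
  exact_mod_cast (Nat.choose_le_two_pow _ _).trans (Nat.pow_le_pow_right two_pos hf)

lemma intMahler_le_two_pow_mul_supNorm {f : ℤ[X]} {d : ℕ} (hf : f.natDegree ≤ d) :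
    intMahler f ≤ 2 ^ d * f.supNorm := by
  rw [← supNorm_map_intCast]
  refine (mahlerMeasure_le_sqrt_natDegree_add_one_mul_supNorm _).trans
    (mul_le_mul_of_nonneg_right ?_ (supNorm_nonneg _))
  rw [natDegree_map_eq_of_injective (RingHom.injective_int _)]
  have h : f.natDegree + 1 ≤ 2 ^ d := Nat.lt_two_pow_self.trans_le (Nat.pow_le_pow_right two_pos hf)
  have h' : (f.natDegree : ℝ) + 1 ≤ 2 ^ d := by exact_mod_cast h
  refine (Real.sqrt_le_left (by positivity)).2 ?_
  nlinarith [f.natDegree.cast_nonneg (α := ℝ)]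

lemma rpow_inv_le_two_mul {d : ℕ} (hd : d ≠ 0) {a b : ℝ} (ha : 0 ≤ a) (hb : 0 ≤ b)
    (h : a ≤ 2 ^ d * b) : a ^ (d : ℝ)⁻¹ ≤ 2 * b ^ (d : ℝ)⁻¹ := by
  refine (Real.rpow_le_rpow ha h (by positivity)).trans (le_of_eq ?_)
  rw [Real.mul_rpow (by positivity) hb, Real.pow_rpow_inv_natCast two_pos.le hd]

/-! ### The growth-decay valuation -/

variable {𝔲 : Ultrafilter ℕ}

lemma gd_mul (x y : Star 𝔲 ℝ) : gd (x * y) = gd x * gd y := map_mul _ _ _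

lemma gd_inv (x : Star 𝔲 ℝ) : gd x⁻¹ = (gd x)⁻¹ := map_inv₀ _ _

lemma gd_one : gd (1 : Star 𝔲 ℝ) = 1 := map_one _

/-- An eventual bound with a fixed constant `C` gives an inequality of classes. -/
lemma gd_le_of_eventually {u v : ℕ → ℝ} {C : ℝ} (hC : 0 ≤ C) (hu : ∀ n, 0 ≤ u n)
    (h : ∀ᶠ n in (𝔲 : Filter ℕ), u n ≤ C * v n) :
    gd (u : Star 𝔲 ℝ) ≤ gd (v : Star 𝔲 ℝ) := by
  rw [gd_le_iff]
  refine ⟨C, ?_⟩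
  rw [abs_coe, abs_coe]
  change ∀ᶠ n in (𝔲 : Filter ℕ), |u n| ≤ C * |v n|
  filter_upwards [h] with n hn
  rw [abs_of_nonneg (hu n)]
  exact hn.trans (mul_le_mul_of_nonneg_left (le_abs_self _) hC)

lemma isInfinitesimal_of_gd_lt_one {x : Star 𝔲 ℝ} (h : gd x < 1) : IsInfinitesimal x := by
  intro ε hε
  by_contra hx
  rw [not_lt] at hx
  refine not_le.2 h ?_
  rw [← gd_one, gd_le_iff]
  refine ⟨ε⁻¹, ?_⟩
  rw [abs_one]
  have h1 : (((ε⁻¹ : ℝ) : Star 𝔲 ℝ)) * ((ε : ℝ) : Star 𝔲 ℝ) = 1 := by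
    change ((ε⁻¹ * ε : ℝ) : Star 𝔲 ℝ) = 1
    rw [inv_mul_cancel₀ hε.ne']
    rfl
  have h2 : (0 : Star 𝔲 ℝ) ≤ ((ε⁻¹ : ℝ) : Star 𝔲 ℝ) :=
    Filter.Germ.const_le (inv_nonneg.2 hε.le)
  rw [← h1]
  exact mul_le_mul_of_nonneg_left hx h2

lemma abs_starPow {x : Star 𝔲 ℝ} (hx : 0 ≤ x) (r : Star 𝔲 ℝ) :
    |starPow x r| = starPow x r := by
  apply abs_of_nonneg
  induction x using Filter.Germ.inductionOn with | h x => ?_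
  induction r using Filter.Germ.inductionOn with | h r => ?_
  have hx' : ∀ᶠ n in (𝔲 : Filter ℕ), 0 ≤ x n := hx
  change ∀ᶠ n in (𝔲 : Filter ℕ), 0 ≤ x n ^ r n
  exact hx'.mono fun n hn => Real.rpow_nonneg hn _

lemma starPow_abs_mul (x y r : Star 𝔲 ℝ) :
    starPow |x * y| r = starPow |x| r * starPow |y| r := by
  induction x using Filter.Germ.inductionOn with | h x => ?_
  induction y using Filter.Germ.inductionOn with | h y => ?_
  induction r using Filter.Germ.inductionOn with | h r => ?_
  rw [← Filter.Germ.coe_mul, abs_coe, abs_coe, abs_coe]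
  refine Filter.Germ.coe_eq.2 (Filter.Eventually.of_forall fun n => ?_)
  change |x n * y n| ^ r n = |x n| ^ r n * |y n| ^ r n
  rw [abs_mul, Real.mul_rpow (abs_nonneg _) (abs_nonneg _)]

lemma frobPow_mul (μ ν : GD 𝔲) (r : Rfin 𝔲) :
    frobPow (μ * ν) r = frobPow μ r * frobPow ν r := by
  obtain ⟨x, rfl⟩ := exists_gd_eq μ
  obtain ⟨y, rfl⟩ := exists_gd_eq ν
  rw [← gd_mul, frobPow_gd, frobPow_gd, frobPow_gd, starPow_abs_mul, gd_mul]

/-- If `|x| ≤ M`, then `|x| ^ r` is at most `(max 1 M) ^ r`, which is bounded as `r` is. -/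
lemma frobPow_le_one {μ : GD 𝔲} (hμ : μ ≤ 1) {r : Rfin 𝔲} (hr : 0 ≤ (r : Star 𝔲 ℝ)) :
    frobPow μ r ≤ 1 := by
  obtain ⟨x, rfl⟩ := exists_gd_eq μ
  obtain ⟨r, hrb⟩ := r
  rw [← gd_one, gd_le_iff] at hμ
  obtain ⟨M, hM⟩ := hμ
  obtain ⟨K, hK⟩ := mem_Rfin.1 hrb
  rw [frobPow_gd, ← gd_one]
  change 0 ≤ r at hr
  change gd (starPow |x| r) ≤ _
  induction x using Filter.Germ.inductionOn with | h x => ?_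
  induction r using Filter.Germ.inductionOn with | h r => ?_
  rw [abs_one, mul_one] at hM
  rw [abs_le_const_iff] at hM hK
  rw [abs_coe]
  have hr' : ∀ᶠ n in (𝔲 : Filter ℕ), 0 ≤ r n := hr
  refine gd_le_of_eventually (u := fun n => |x n| ^ r n) (v := fun _ => 1) (C := (max 1 M) ^ K)
    (by positivity) (fun n => by positivity) ?_
  filter_upwards [hM, hK, hr'] with n h1 h2 h3
  rw [mul_one]
  exact (Real.rpow_le_rpow (abs_nonneg _) (h1.trans (le_max_right 1 M)) h3).trans
    (Real.rpow_le_rpow_of_exponent_le (le_max_left _ _) ((le_abs_self _).trans h2))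

lemma one_sub_invNat_nonneg (d : Star 𝔲 ℕ) : 0 ≤ ((1 - invNat d : Rfin 𝔲) : Star 𝔲 ℝ) := by
  induction d using Filter.Germ.inductionOn with | h d => ?_
  change ∀ᶠ n in (𝔲 : Filter ℕ), 0 ≤ 1 - ((d n : ℝ))⁻¹
  exact Filter.Eventually.of_forall fun n => sub_nonneg.2 (Nat.cast_inv_le_one _)

/-! ### Nonstandard polynomials -/

lemma eventually_ne_zero_of_pos {d : ℕ → ℕ} (hd : 0 < (d : Star 𝔲 ℕ)) :
    ∀ᶠ n in (𝔲 : Filter ℕ), d n ≠ 0 :=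
  (Filter.Germ.coe_pos.1 hd).mono fun _ h => h.ne'

lemma mahlerN_nonneg (f : Star 𝔲 ℤ[X]) (d : Star 𝔲 ℕ) : 0 ≤ mahlerN d f := by
  induction f using Filter.Germ.inductionOn with | h f => ?_
  induction d using Filter.Germ.inductionOn with | h d => ?_
  change ∀ᶠ n in (𝔲 : Filter ℕ), 0 ≤ intMahler (f n) ^ ((d n : ℝ))⁻¹
  exact Filter.Eventually.of_forall fun n => Real.rpow_nonneg (mahlerMeasure_nonneg _) _

lemma starDeg_starResProd_le {f g : Star 𝔲 ℤ[X]} {d e : Star 𝔲 ℕ} (hf : starDeg f ≤ d)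
    (hg : starDeg g ≤ e) : starDeg (starResProd f g) ≤ d * e := by
  induction f using Filter.Germ.inductionOn with | h f => ?_
  induction g using Filter.Germ.inductionOn with | h g => ?_
  induction d using Filter.Germ.inductionOn with | h d => ?_
  induction e using Filter.Germ.inductionOn with | h e => ?_
  have hf' : ∀ᶠ n in (𝔲 : Filter ℕ), (f n).natDegree ≤ d n := hf
  have hg' : ∀ᶠ n in (𝔲 : Filter ℕ), (g n).natDegree ≤ e n := hg
  change ∀ᶠ n in (𝔲 : Filter ℕ), (resProd (f n) (g n)).natDegree ≤ d n * e n
  filter_upwards [hf', hg'] with n h1 h2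
  exact (natDegree_resProd_le _ _).trans (Nat.mul_le_mul h1 h2)

/-- Heights and Mahler measures agree up to the factors `2 ^ d`, which the normalization turns into
bounded ones. -/
lemma gd_heightN_eq {f : Star 𝔲 ℤ[X]} {d : Star 𝔲 ℕ} (hd : 0 < d) (hf : starDeg f ≤ d) :
    gd (heightN d f) = gd (mahlerN d f) := by
  induction f using Filter.Germ.inductionOn with | h f => ?_
  induction d using Filter.Germ.inductionOn with | h d => ?_
  have hf' : ∀ᶠ n in (𝔲 : Filter ℕ), (f n).natDegree ≤ d n := hf
  have hd' := eventually_ne_zero_of_pos hd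
  have hM : ∀ n, 0 ≤ intMahler (f n) := fun n => mahlerMeasure_nonneg _
  have hS : ∀ n, 0 ≤ (f n).supNorm := fun n => supNorm_nonneg _
  refine le_antisymm
    (gd_le_of_eventually (u := fun n => (f n).supNorm ^ ((d n : ℝ))⁻¹)
      (v := fun n => intMahler (f n) ^ ((d n : ℝ))⁻¹) two_pos.le
      (fun n => Real.rpow_nonneg (hS n) _) ?_)
    (gd_le_of_eventually (u := fun n => intMahler (f n) ^ ((d n : ℝ))⁻¹)
      (v := fun n => (f n).supNorm ^ ((d n : ℝ))⁻¹) two_pos.le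
      (fun n => Real.rpow_nonneg (hM n) _) ?_)
  · filter_upwards [hf', hd'] with n h1 h2
    exact rpow_inv_le_two_mul h2 (hS n) (hM n) (supNorm_le_two_pow_mul_intMahler h1)
  · filter_upwards [hf', hd'] with n h1 h2
    exact rpow_inv_le_two_mul h2 (hM n) (hS n) (intMahler_le_two_pow_mul_supNorm h1)

lemma growth_eq {f : Star 𝔲 ℤ[X]} {d : Star 𝔲 ℕ} (hd : 0 < d) (hf : starDeg f ≤ d) :
    growth d f = (gd (mahlerN d f))⁻¹ := by
  rw [growth, gd_inv, gd_heightN_eq hd hf]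

lemma gd_mahlerN_starResProd_le {f g : Star 𝔲 ℤ[X]} {d e : Star 𝔲 ℕ} (hd : 0 < d) (he : 0 < e)
    (hf : starDeg f ≤ d) (hg : starDeg g ≤ e) :
    gd (mahlerN (d * e) (starResProd f g)) ≤ gd (mahlerN d f) * gd (mahlerN e g) := by
  rw [← gd_mul]
  induction f using Filter.Germ.inductionOn with | h f => ?_
  induction g using Filter.Germ.inductionOn with | h g => ?_
  induction d using Filter.Germ.inductionOn with | h d => ?_
  induction e using Filter.Germ.inductionOn with | h e => ?_
  have hf' : ∀ᶠ n in (𝔲 : Filter ℕ), (f n).natDegree ≤ d n := hf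
  have hg' : ∀ᶠ n in (𝔲 : Filter ℕ), (g n).natDegree ≤ e n := hg
  refine gd_le_of_eventually
    (u := fun n => intMahler (resProd (f n) (g n)) ^ (((d n * e n : ℕ) : ℝ))⁻¹)
    (v := fun n => intMahler (f n) ^ ((d n : ℝ))⁻¹ * intMahler (g n) ^ ((e n : ℝ))⁻¹) (C := 1)
    one_pos.le (fun n => Real.rpow_nonneg (mahlerMeasure_nonneg _) _) ?_
  filter_upwards [hf', hg', eventually_ne_zero_of_pos hd, eventually_ne_zero_of_pos he]
    with n h1 h2 h3 h4
  rw [one_mul]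
  exact rpow_intMahler_resProd_le h3 h4 h1 h2

lemma mahlerN_ne_zero {f : Star 𝔲 ℤ[X]} (hf : f ≠ 0) (d : Star 𝔲 ℕ) : mahlerN d f ≠ 0 := by
  induction f using Filter.Germ.inductionOn with | h f => ?_
  induction d using Filter.Germ.inductionOn with | h d => ?_
  intro h
  have h' : ∀ᶠ n in (𝔲 : Filter ℕ), intMahler (f n) ^ ((d n : ℝ))⁻¹ = 0 := Filter.Germ.coe_eq.1 h
  refine hf (Filter.Germ.coe_eq.2 (h'.mono fun n hn => ?_))
  by_contra hfn
  exact (Real.rpow_pos_of_pos (one_pos.trans_le (one_le_intMahler hfn)) _).ne' hn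

/-- The decay estimate in the growth-decay semi-ring. The tropical sum is attained by one of its
terms, and the ultrafilter decides which of the two bounds holds almost everywhere. -/
lemma decay_starResProd_le {f g : Star 𝔲 ℤ[X]} {θ η : ℝ} {d e : Star 𝔲 ℕ} (hd : 0 < d)
    (he : 0 < e) (hf : f ∈ Approx θ d) (hg : g ∈ Approx η e) :
    decay (d * e) (θ * η) (starResProd f g) ≤
      max
        (gd (starPow (mahlerN d f) ((1 - invNat e : Rfin 𝔲) : Star 𝔲 ℝ)) * gd (mahlerN e g) *
          frobPow (decay d θ f) (invNat e))
        (gd (mahlerN d f) * gd (starPow (mahlerN e g) ((1 - invNat d : Rfin 𝔲) : Star 𝔲 ℝ)) *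
          frobPow (decay e η g) (invNat d)) := by
  rw [decay, decay, decay, frobPow_gd, frobPow_gd, abs_starPow (abs_nonneg _),
    abs_starPow (abs_nonneg _), ← gd_mul, ← gd_mul, ← gd_mul, ← gd_mul]
  obtain ⟨hf1, hf2⟩ := hf
  obtain ⟨hg1, hg2⟩ := hg
  have hf2 := hf2 1 one_pos
  have hg2 := hg2 1 one_pos
  induction f using Filter.Germ.inductionOn with | h f => ?_
  induction g using Filter.Germ.inductionOn with | h g => ?_
  induction d using Filter.Germ.inductionOn with | h d => ?_
  induction e using Filter.Germ.inductionOn with | h e => ?_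
  have hE : ∀ (x : ℝ) (p : ℕ → ℤ[X]), |starEval x (p : Star 𝔲 ℤ[X])| =
      ((fun n => |aeval x (p n)| : ℕ → ℝ) : Star 𝔲 ℝ) := fun x p =>
    abs_coe (fun n => aeval x (p n))
  have hE' : |starEval (θ * η) (starResProd (f : Star 𝔲 ℤ[X]) (g : Star 𝔲 ℤ[X]))| =
      ((fun n => |aeval (θ * η) (resProd (f n) (g n))| : ℕ → ℝ) : Star 𝔲 ℝ) :=
    hE _ fun n => resProd (f n) (g n)
  rw [hE']
  rw [hE] at hf2 hg2 ⊢
  rw [hE]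
  have hf' : ∀ᶠ n in (𝔲 : Filter ℕ), (f n).natDegree ≤ d n := hf1
  have hg' : ∀ᶠ n in (𝔲 : Filter ℕ), (g n).natDegree ≤ e n := hg1
  have hfθ : ∀ᶠ n in (𝔲 : Filter ℕ), |aeval θ (f n)| < 1 := Filter.Germ.coe_lt.1 hf2
  have hgη : ∀ᶠ n in (𝔲 : Filter ℕ), |aeval η (g n)| < 1 := Filter.Germ.coe_lt.1 hg2
  have hC := (one_pos.trans_le (one_le_pairConst θ η)).le
  have key := (((((hf'.and hg').and hfθ).and hgη).and (eventually_ne_zero_of_pos hd)).and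
    (eventually_ne_zero_of_pos he)).mono fun n h =>
      rpow_abs_aeval_resProd_le h.1.2 h.2 h.1.1.1.1.1 h.1.1.1.1.2 h.1.1.1.2 h.1.1.2
  rcases Ultrafilter.eventually_or.1 key with h | h
  · exact le_max_of_le_left (gd_le_of_eventually hC (fun n => by positivity) h)
  · exact le_max_of_le_right (gd_le_of_eventually hC (fun n => by positivity) h)

/-- If `|f(θ)| ^ (1 / d) < ε ≤ 1` then its `d`-th power `|f(θ)|` is below `ε` too. -/
lemma isInfinitesimal_of_decay_lt_one {f : Star 𝔲 ℤ[X]} {θ : ℝ} {d : Star 𝔲 ℕ} (hd : 0 < d)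
    (h : decay d θ f < 1) : IsInfinitesimal (starEval θ f) := by
  have h1 := isInfinitesimal_of_gd_lt_one h
  intro ε hε
  have h2 := h1 (min ε 1) (lt_min hε one_pos)
  rw [abs_starPow (abs_nonneg _)] at h2
  generalize starEval θ f = x at h2 ⊢
  induction x using Filter.Germ.inductionOn with | h x => ?_
  induction d using Filter.Germ.inductionOn with | h d => ?_
  rw [abs_coe] at h2 ⊢
  have h3 : ∀ᶠ n in (𝔲 : Filter ℕ), |x n| ^ ((d n : ℝ))⁻¹ < min ε 1 := Filter.Germ.coe_lt.1 h2
  refine Filter.Germ.coe_lt.2 ?_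
  filter_upwards [h3, eventually_ne_zero_of_pos hd] with n h4 h5
  have h6 : 0 ≤ |x n| ^ ((d n : ℝ))⁻¹ := by positivity
  have h7 : (|x n| ^ ((d n : ℝ))⁻¹) ^ d n = |x n| := Real.rpow_inv_natCast_pow (abs_nonneg _) h5
  calc |x n| = (|x n| ^ ((d n : ℝ))⁻¹) ^ d n := h7.symm
    _ ≤ |x n| ^ ((d n : ℝ))⁻¹ := pow_le_of_le_one h6 (h4.le.trans (min_le_right _ _)) h5
    _ < ε := h4.trans_le (min_le_left _ _)

lemma starResProd_zero_left (g : Star 𝔲 ℤ[X]) : starResProd 0 g = 0 := by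
  induction g using Filter.Germ.inductionOn with | h g => ?_
  exact Filter.Germ.coe_eq.2 (Filter.Eventually.of_forall fun n => resProd_zero_left _)

lemma starResProd_zero_right (f : Star 𝔲 ℤ[X]) : starResProd f 0 = 0 := by
  induction f using Filter.Germ.inductionOn with | h f => ?_
  exact Filter.Germ.coe_eq.2 (Filter.Eventually.of_forall fun n => resProd_zero_right _)

lemma gd_starPow_mahlerN (f : Star 𝔲 ℤ[X]) (d : Star 𝔲 ℕ) (r : Rfin 𝔲) :
    gd (starPow (mahlerN d f) (r : Star 𝔲 ℝ)) = frobPow (gd (mahlerN d f)) r := by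
  rw [frobPow_gd, abs_of_nonneg (mahlerN_nonneg f d)]

/-- The growth condition in multiplicative form: `μ < μ_d(f)` means `𝔪_d(f) · μ < 1`. -/
lemma gd_mahlerN_mul_lt_one {f : Star 𝔲 ℤ[X]} {d : Star 𝔲 ℕ} (hd : 0 < d) (hf0 : f ≠ 0)
    (hf : starDeg f ≤ d) {μ : GD 𝔲} (h : μ < growth d f) : gd (mahlerN d f) * μ < 1 := by
  rw [growth_eq hd hf] at h
  have h0 : gd (mahlerN d f) ≠ 0 := (Valuation.ne_zero_iff _).2 (mahlerN_ne_zero hf0 d)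
  have := mul_lt_mul_of_pos_left h (zero_lt_iff.2 h0)
  rwa [mul_inv_cancel₀ h0] at this

lemma zero_mem_approxGrowth {μ : GD 𝔲} {θ : ℝ} {d : Star 𝔲 ℕ} :
    (0 : Star 𝔲 ℤ[X]) ∈ ApproxGrowth μ θ d := by
  refine ⟨⟨?_, ?_⟩, Or.inl rfl⟩
  · have : starDeg (0 : Star 𝔲 ℤ[X]) = 0 :=
      Filter.Germ.coe_eq.2 (Filter.Eventually.of_forall fun n => natDegree_zero)
    rw [this]
    induction d using Filter.Germ.inductionOn with | h d => ?_
    exact Filter.Eventually.of_forall fun n => Nat.zero_le _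
  · have : starEval θ (0 : Star 𝔲 ℤ[X]) = 0 :=
      Filter.Germ.coe_eq.2 (Filter.Eventually.of_forall fun n => map_zero _)
    intro ε hε
    rw [this, abs_zero]
    exact Filter.Germ.const_lt hε

/-- The two decay conditions turn the two terms of the decay estimate into
`(𝔪_d(f) μ) ^ (1 - 1 / e) · 𝔪_e(g) ν` and `𝔪_d(f) μ · (𝔪_e(g) ν) ^ (1 - 1 / d)`, which are below `1`
by the growth conditions. -/
lemma starResProd_mem_approxGrowth {f g : Star 𝔲 ℤ[X]} {θ η : ℝ} {d e : Star 𝔲 ℕ} (hd : 0 < d)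
    (he : 0 < e) {μ ν : GD 𝔲}
    (hf : f ∈ ApproxGrowthDecay μ (frobPow μ (1 - invNat e) * ν) e θ d)
    (hg : g ∈ ApproxGrowthDecay ν (μ * frobPow ν (1 - invNat d)) d η e) :
    starResProd f g ∈ ApproxGrowth (μ * ν) (θ * η) (d * e) := by
  obtain ⟨⟨hfA, hf⟩, hfd⟩ := hf
  obtain ⟨⟨hgA, hg⟩, hgd⟩ := hg
  by_cases hf0 : f = 0
  · rw [hf0, starResProd_zero_left]
    exact zero_mem_approxGrowth
  by_cases hg0 : g = 0
  · rw [hg0, starResProd_zero_right]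
    exact zero_mem_approxGrowth
  have hf := hf.resolve_left hf0
  have hg := hg.resolve_left hg0
  have hde : 0 < d * e := mul_pos hd he
  have hdeg := starDeg_starResProd_le hfA.1 hgA.1
  refine ⟨⟨hdeg, isInfinitesimal_of_decay_lt_one hde
    ((decay_starResProd_le hd he hfA hgA).trans_lt (max_lt ?_ ?_))⟩, ?_⟩
  · have h1 := frobPow_le_one (gd_mahlerN_mul_lt_one hd hf0 hfA.1 hf).le (one_sub_invNat_nonneg e)
    have h2 := gd_mahlerN_mul_lt_one he hg0 hgA.1 hg
    rw [gd_starPow_mahlerN]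
    refine (mul_le_mul_right hfd _).trans_lt ?_
    rw [mul_mul_mul_comm, ← frobPow_mul]
    exact (mul_le_of_le_one_left' h1).trans_lt h2
  · have h1 := frobPow_le_one (gd_mahlerN_mul_lt_one he hg0 hgA.1 hg).le (one_sub_invNat_nonneg d)
    have h2 := gd_mahlerN_mul_lt_one hd hf0 hfA.1 hf
    rw [gd_starPow_mahlerN]
    refine (mul_le_mul_right hgd _).trans_lt ?_
    rw [mul_mul_mul_comm, ← frobPow_mul]
    exact (mul_le_of_le_one_right' h1).trans_lt h2
  · rw [or_iff_not_imp_left]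
    intro h0
    rw [growth_eq hde hdeg]
    rw [growth_eq hd hfA.1] at hf
    rw [growth_eq he hgA.1] at hg
    have h1 : gd (mahlerN (d * e) (starResProd f g)) ≠ 0 :=
      (Valuation.ne_zero_iff _).2 (mahlerN_ne_zero h0 _)
    refine (mul_lt_mul'' hf hg zero_le zero_le).trans_le ?_
    rw [← mul_inv]
    exact inv_anti₀ (zero_lt_iff.2 h1) (gd_mahlerN_starResProd_le hd he hfA.1 hgA.1)

end PolyApprox

end

open PolyApprox in
theorem theorem6p3 (𝔲 : Ultrafilter ℕ) (h𝔲 : (𝔲 : Filter ℕ) ≤ Filter.cofinite) (θ η : ℝ)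
    (d e : Star 𝔲 ℕ) (hd : 0 < d) (he : 0 < e) :
    -- the bound for the normalized decay of the resultant product
    (∀ f ∈ Approx θ d, ∀ g ∈ Approx η e,
      decay (d * e) (θ * η) (starResProd f g) ≤
        max
          (gd (starPow (mahlerN d f) ((1 - invNat e : Rfin 𝔲) : Star 𝔲 ℝ)) * gd (mahlerN e g) *
            frobPow (decay d θ f) (invNat e))
          (gd (mahlerN d f) * gd (starPow (mahlerN e g) ((1 - invNat d : Rfin 𝔲) : Star 𝔲 ℝ)) *
            frobPow (decay e η g) (invNat d))) ∧
    -- the resultant product maps the first two approximation sets into the third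
    (∀ μ ν : GD 𝔲, μ < 1 → ν < 1 →
      ∀ f ∈ ApproxGrowthDecay μ (frobPow μ (1 - invNat e) * ν) e θ d,
      ∀ g ∈ ApproxGrowthDecay ν (μ * frobPow ν (1 - invNat d)) d η e,
        starResProd f g ∈ ApproxGrowth (μ * ν) (θ * η) (d * e)) ∧
    -- it is bilinear with respect to the ordinary (Cauchy) product of polynomials
    (∀ f f' g : Star 𝔲 ℤ[X],
      starResProd (f * f') g = starResProd f g * starResProd f' g) ∧
    (∀ f g g' : Star 𝔲 ℤ[X],
      starResProd f (g * g') = starResProd f g * starResProd f g') ∧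
    -- it agrees with the product of numerator-denominator pairs on linear polynomials
    (∀ a b a' b' : Star 𝔲 ℤ, a ≠ 0 → a' ≠ 0 →
      starResProd (linPoly a b) (linPoly a' b') = linPoly (a * a') (b * b')) := by
  refine ⟨fun f hf g hg => decay_starResProd_le hd he hf hg,
    fun μ ν _ _ f hf g hg => starResProd_mem_approxGrowth hd he hf hg, ?_, ?_, ?_⟩
  · intro f f' g
    induction f using Filter.Germ.inductionOn with | h f => ?_
    induction f' using Filter.Germ.inductionOn with | h f' => ?_
    induction g using Filter.Germ.inductionOn with | h g => ?_
    exact Filter.Germ.coe_eq.2 (Filter.Eventually.of_forall fun n => resProd_mul_left _ _ _)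
  · intro f g g'
    induction f using Filter.Germ.inductionOn with | h f => ?_
    induction g using Filter.Germ.inductionOn with | h g => ?_
    induction g' using Filter.Germ.inductionOn with | h g' => ?_
    exact Filter.Germ.coe_eq.2 (Filter.Eventually.of_forall fun n => resProd_mul_right _ _ _)
  · intro a b a' b' ha ha'
    induction a using Filter.Germ.inductionOn with | h a => ?_
    induction b using Filter.Germ.inductionOn with | h b => ?_
    induction a' using Filter.Germ.inductionOn with | h a' => ?_
    induction b' using Filter.Germ.inductionOn with | h b' => ?_
    have h1 : ∀ᶠ n in (𝔲 : Filter ℕ), a n ≠ 0 :=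
      Ultrafilter.eventually_not.2 fun h => ha (Filter.Germ.coe_eq.2 h)
    have h2 : ∀ᶠ n in (𝔲 : Filter ℕ), a' n ≠ 0 :=
      Ultrafilter.eventually_not.2 fun h => ha' (Filter.Germ.coe_eq.2 h)
    refine Filter.Germ.coe_eq.2 ?_
    filter_upwards [h1, h2] with n h3 h4
    exact resProd_linear _ _ h3 h4
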